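/- Let $\mathit{Act}$ be a non-empty set of actions. A communication function is a commutative and associative partial binary operation $\gamma$ on $\mathit{Act}$ (both sides of the laws being defined or undefined together). For each $\gamma$, let $\mathrm{ACP}^*_{01}(\gamma)$ be the transition system space whose states are the expressions $$p ::= 0 \mid 1 \mid a \mid p\cdot p \mid p+p \mid p^* \mid p\parallel p \mid \partial_H(p)\qquad(a\in \mathit{Act},\ H\subseteq \mathit{Act})$$ and whose transition relation and termination predicate $\downarrow$ are the least relations such that: $1{\downarrow}$; $a\xrightarrow{a}1$; $p+q$ has the transitions and the termination of both $p$ and $q$; if $p\xrightarrow{a}p'$ then $p\cdot q\xrightarrow{a}p'\cdot q$; if $p{\downarrow}$ and $q\xrightarrow{a}q'$ then $p\cdot q\xrightarrow{a}q'$; if $p{\downarrow}$ and $q{\downarrow}$ then $p\cdot q{\downarrow}$ and $p\parallel q{\downarrow}$; if $p\xrightarrow{a}p'$ then $p^*\xrightarrow{a}p'\cdot p^*$; $p^*{\downarrow}$; if $p\xrightarrow{a}p'$ then $p\parallel q\xrightarrow{a}p'\parallel q$ and $q\parallel p\xrightarrow{a}q\parallel p'$; if $p\xrightarrow{a}p'$,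 $q\xrightarrow{b}q'$ and $\gamma(a,b)$ is defined then $p\parallel q\xrightarrow{\gamma(a,b)}p'\parallel q'$; if $p\xrightarrow{a}p'$ and $a\notin H$ then $\partial_H(p)\xrightarrow{a}\partial_H(p')$; if $p{\downarrow}$ then $\partial_H(p){\downarrow}$. Let $\mathrm{PA}^*_{01}$ be the space of the expressions without $\partial_H$, with the transitions obtained when $\gamma$ is nowhere defined, and let $\bigcup_\gamma\mathrm{ACP}^*_{01}$ be the disjoint union of the spaces $\mathrm{ACP}^*_{01}(\gamma)$ over all communication functions $\gamma$ on $\mathit{Act}$. Bisimilarity is strong bisimilarity, with related states required to agree on termination. In a transition system space, a strongly connected component $C$ is a maximal set of mutually reachable states; it is trivial if it consists of a single state that has no transition to itself. A state is normed if it can reach a terminating state. A normed exit transition from $s\in C$ is a pair $(a,s')$ with $s\xrightarrow{a}s'$, $s'\notin C$ and $s'$ normed; $s\in C$ is an alive exit state of $C$ if $s{\downarrow}$ or $s$ has a normed exit transition. Write $(a,s)\sim(a',s')$ if $a=a'$ and $s,s'$ lie in the same strongly connected component. An alive exit state $s\in C$ is maximal modulo $\sim$ if for every alive exit state $s'\in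 C$ and every normed exit transition $e'$ from $s'$ there is a normed exit transition $e$ from $s$ with $e\sim e'$. Theorem. $\mathrm{PA}^*_{01}$ is less expressive than $\bigcup_\gamma\mathrm{ACP}^*_{01}$ modulo bisimilarity: every $\mathrm{PA}^*_{01}$ expression is bisimilar to a state of $\bigcup_\gamma\mathrm{ACP}^*_{01}$, and some state of $\bigcup_\gamma\mathrm{ACP}^*_{01}$ is not bisimilar to any $\mathrm{PA}^*_{01}$ expression. Moreover, let $a,b,c,d,e\in \mathit{Act}$ be pairwise distinct and let $\gamma$ be a communication function with $\gamma(b,c)=e$ and such that $\gamma(a,c)$ is undefined or different from $e$. Then, in $\mathrm{ACP}^*_{01}(\gamma)$, the expression $p_0=((1\cdot(a\cdot b)^*)\cdot d)\parallel c$ belongs to a non-trivial strongly connected component that has an alive exit state but no maximal alive exit state modulo $\sim$, and $p_0$ is not bisimilar to any $\mathrm{PA}^*_{01}$ expression. -/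

import Mathlib

universe u

/-- A labelled transition system space: a non-empty set of states with a labelled
transition relation and a termination predicate. -/
structure TSS (Act : Type u) where
  State : Type u
  nonempty : Nonempty State
  Step : State → Act → State → Prop
  Term : State → Prop

namespace TSS

variable {Act : Type u}

/-- `s` can do a transition to `s'` with some label. -/
def StepAny (T : TSS Act) (s s' : T.State) : Prop := ∃ a, T.Step s a s'

/-- `s'` is reachable from `s` in zero or more transitions. -/
def Reachable (T : TSS Act) : T.State → T.State → Prop :=
  Relation.ReflTransGen T.StepAny

/-- Some terminating state is reachable. -/
def Normed (T : TSS Act) (s : T.State) : Prop := ∃ s', T.Reachable s s' ∧ T.Term s'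

/-- `R` is a (strong) bisimulation between `T₁` and `T₂`. -/
structure IsBisimulation (T₁ T₂ : TSS Act) (R : T₁.State → T₂.State → Prop) : Prop where
  forth : ∀ s₁ s₂, R s₁ s₂ → ∀ a s₁', T₁.Step s₁ a s₁' → ∃ s₂', T₂.Step s₂ a s₂' ∧ R s₁' s₂'
  back : ∀ s₁ s₂, R s₁ s₂ → ∀ a s₂', T₂.Step s₂ a s₂' → ∃ s₁', T₁.Step s₁ a s₁' ∧ R s₁' s₂'
  term : ∀ s₁ s₂, R s₁ s₂ → (T₁.Term s₁ ↔ T₂.Term s₂)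

/-- Bisimilarity of a state of `T₁` and a state of `T₂`. -/
def Bisimilar (T₁ T₂ : TSS Act) (s₁ : T₁.State) (s₂ : T₂.State) : Prop :=
  ∃ R, IsBisimulation T₁ T₂ R ∧ R s₁ s₂

/-- `T₁` is (strictly) less expressive than `T₂`, modulo bisimilarity. -/
def LessExpressive (T₁ T₂ : TSS Act) : Prop :=
  (∀ s₁ : T₁.State, ∃ s₂ : T₂.State, Bisimilar T₁ T₂ s₁ s₂) ∧
  (∃ s₂ : T₂.State, ∀ s₁ : T₁.State, ¬ Bisimilar T₁ T₂ s₁ s₂)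

/-- A strongly connected component: a maximal set of mutually reachable states. -/
def IsSCC (T : TSS Act) (C : Set T.State) : Prop :=
  Maximal (fun D : Set T.State => ∀ s ∈ D, ∀ s' ∈ D, T.Reachable s s') C

/-- A component is trivial if it is a single state without a transition to itself. -/
def IsTrivial (T : TSS Act) (C : Set T.State) : Prop :=
  ∃ s, C = {s} ∧ ¬ T.StepAny s s

/-- `s` and `s'` lie in the same strongly connected component. -/
def SameSCC (T : TSS Act) (s s' : T.State) : Prop := ∃ C, T.IsSCC C ∧ s ∈ C ∧ s' ∈ C

/-- The equivalence `∼` on pairs of an action and a state. -/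
def ExitEquiv (T : TSS Act) (x y : Act × T.State) : Prop := x.1 = y.1 ∧ T.SameSCC x.2 y.2

/-- The exit transitions from the state `s` of the component `C`. -/
def exits (T : TSS Act) (C : Set T.State) (s : T.State) : Set (Act × T.State) :=
  {x | T.Step s x.1 x.2 ∧ x.2 ∉ C}

/-- The normed exit transitions from the state `s` of the component `C`. -/
def normedExits (T : TSS Act) (C : Set T.State) (s : T.State) : Set (Act × T.State) :=
  {x | x ∈ T.exits C s ∧ T.Normed x.2}

/-- `s` is an alive exit state of the component `C`. -/
def IsAliveExit (T : TSS Act) (C : Set T.State) (s : T.State) : Prop :=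
  s ∈ C ∧ (T.Term s ∨ (T.normedExits C s).Nonempty)

/-- `s` is a maximal (modulo `∼`) alive exit state of the component `C`. -/
def IsMaximalAliveExit (T : TSS Act) (C : Set T.State) (s : T.State) : Prop :=
  T.IsAliveExit C s ∧
    ∀ s', T.IsAliveExit C s' → ∀ e' ∈ T.normedExits C s',
      ∃ e ∈ T.normedExits C s, T.ExitEquiv e e'

end TSS

/-- A communication function: a commutative and associative partial binary operation on actions
(`none` means undefined; both sides of an equation are defined or undefined together). -/
structure CommFun (Act : Type u) where
  toFun : Act → Act → Option Act
  comm : ∀ a b, toFun a b = toFun b a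
  assoc : ∀ a b c,
    (toFun a b).bind (fun x => toFun x c) = (toFun b c).bind (fun y => toFun a y)

/-- The communication function that is everywhere undefined. -/
def CommFun.empty (Act : Type u) : CommFun Act where
  toFun _ _ := none
  comm _ _ := rfl
  assoc _ _ _ := rfl

/-- ACP*01 expressions. -/
inductive ACPExpr (Act : Type u) : Type u
  | dl : ACPExpr Act
  | emp : ACPExpr Act
  | act : Act → ACPExpr Act
  | seq : ACPExpr Act → ACPExpr Act → ACPExpr Act
  | alt : ACPExpr Act → ACPExpr Act → ACPExpr Act
  | star : ACPExpr Act → ACPExpr Act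
  | par : ACPExpr Act → ACPExpr Act → ACPExpr Act
  | encap : Set Act → ACPExpr Act → ACPExpr Act

namespace ACPExpr

variable {Act : Type u}

/-- The termination predicate. -/
inductive Term : ACPExpr Act → Prop
  | emp : Term emp
  | alt_left {p q} : Term p → Term (alt p q)
  | alt_right {p q} : Term q → Term (alt p q)
  | seq {p q} : Term p → Term q → Term (seq p q)
  | star {p} : Term (star p)
  | par {p q} : Term p → Term q → Term (par p q)
  | encap {H p} : Term p → Term (encap H p)

/-- The transition relation for the communication function `γ`. -/
inductive Step (γ : CommFun Act) : ACPExpr Act → Act → ACPExpr Act → Prop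
  | act {a} : Step γ (act a) a emp
  | alt_left {p q a p'} : Step γ p a p' → Step γ (alt p q) a p'
  | alt_right {p q a q'} : Step γ q a q' → Step γ (alt p q) a q'
  | seq_left {p q a p'} : Step γ p a p' → Step γ (seq p q) a (seq p' q)
  | seq_right {p q a q'} : Term p → Step γ q a q' → Step γ (seq p q) a q'
  | star {p a p'} : Step γ p a p' → Step γ (star p) a (seq p' (star p))
  | par_left {p q a p'} : Step γ p a p' → Step γ (par p q) a (par p' q)
  | par_right {p q a q'} : Step γ q a q' → Step γ (par p q) a (par p q')
  | par_comm {p q a b c p' q'} : Step γ p a p' → Step γ q b q' → γ.toFun a b = some c →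
      Step γ (par p q) c (par p' q')
  | encap {H p a p'} : Step γ p a p' → a ∉ H → Step γ (encap H p) a (encap H p')

/-- The expression contains no encapsulation. -/
def EncapFree : ACPExpr Act → Prop
  | dl => True
  | emp => True
  | act _ => True
  | seq p q => EncapFree p ∧ EncapFree q
  | alt p q => EncapFree p ∧ EncapFree q
  | star p => EncapFree p
  | par p q => EncapFree p ∧ EncapFree q
  | encap _ _ => False

end ACPExpr

/-- The transition system space ACP*01 over the actions `Act` for the communication
function `γ`. -/
def ACP {Act : Type u} (γ : CommFun Act) : TSS Act where
  State := ACPExpr Act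
  nonempty := ⟨ACPExpr.dl⟩
  Step := ACPExpr.Step γ
  Term := ACPExpr.Term

/-- The transition system space PA*01 over the actions `Act`: expressions without encapsulation,
with the transitions obtained when no two actions communicate. -/
def PA (Act : Type u) : TSS Act where
  State := {p : ACPExpr Act // p.EncapFree}
  nonempty := ⟨⟨ACPExpr.dl, trivial⟩⟩
  Step p a q := ACPExpr.Step (CommFun.empty Act) p.1 a q.1
  Term p := ACPExpr.Term p.1

/-- The disjoint union of the transition system spaces `ACP γ` over all communication
functions `γ` on `Act`. -/
def ACPUnion (Act : Type u) : TSS Act where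
  State := CommFun Act × ACPExpr Act
  nonempty := ⟨(CommFun.empty Act, ACPExpr.dl)⟩
  Step p a q := q.1 = p.1 ∧ ACPExpr.Step p.1 p.2 a q.2
  Term p := ACPExpr.Term p.2

/-- The expression `1·(a·b)*·d ∥ c`, where `·` associates to the left and binds stronger
than `∥`. -/
def witnessExpr {Act : Type u} (a b c d : Act) : ACPExpr Act :=
  .par (.seq (.seq .emp (.star (.seq (.act a) (.act b)))) (.act d)) (.act c)

/-!
The expression `witnessExpr a b c d` has exactly six derivatives: `u₀ = (1·(a·b)*·d) ∥ c` itself,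
`u₁`, in which the loop has done `a`, the states `v₀` and `v₁` with the loop in the same positions
but `c` already done, `w = 1 ∥ c` and `t = 1 ∥ 1`. The loops `u₀ ⇄ u₁` and `v₀ ⇄ v₁` are strongly
connected components. From the first one, an exit labelled `e` to the second one is only possible
in `u₁` (here `γ a c ≠ some e` is needed), and an exit labelled `d` only in `u₀`, so no alive exit
state is maximal.

That no `PA` expression is bisimilar to `u₀` does not depend on the labels at all. Every `PA`
expression bisimilar to a derivative of the witness is assigned a type among `u₀, u₁, v₀, v₁, w, t`
according to the unlabelled transition graph, in which the only edges whose presence depends on the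
communication function are `u₀ → v₁` and `u₀ → t` (`Node.May` against `Node.Must`). The heart of the
proof is `unloopable_of_reach`: by structural induction on `p`, if `p'` is reachable from `p` and
`p'·Q` has type `u₀` or `u₁`, then `Q` has a transition to an expression of type `u₀` or `u₁`.
Applied to `p·1` this is a contradiction, since `1` has no transitions.

* For an iteration `s*`, the induction hypothesis shows that the loop runs through `s*`. Then no
  `r·(s*·Q)` can be of type `v₀`, `v₁`, `w` or `t`, since it could return to the loop before
  terminating. So both exits `u₀ → w` and `u₁ → v₀` are made by `Q` after termination of `r`, and
  then `u₁` would have the exit to `w` as well (`not_typ_u1_of_w`).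
* For a parallel composition `x ∥ y`, suppose that `x` makes the step `u₀ → w`. Since `w` only has
  transitions to `t`, either `y` terminates without having any transition, and can be dropped, or
  every transition of `y` is its last one (it is the pending `c`). In the latter case interleaving
  cannot produce both `u₁ → v₀` and `u₁ → v₁` (`not_typ_u1_par`): all transitions of `y` lead to
  the same type, and a component that makes one of these exits itself would leave the step of `y`
  pending, which neither `v₀` nor `v₁` allows.

Because the argument is unlabelled and only needs `γ b c` to be defined, it also applies with a
single action `a` and `γ a a = a`; this gives the strictness over an arbitrary non-empty `Act`.
-/

/-! ### Inversion of transitions and termination -/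

namespace ACPExpr

variable {Act : Type u} {γ : CommFun Act}

@[simp] theorem term_emp : Term (emp : ACPExpr Act) := .emp

@[simp] theorem term_act {a : Act} : ¬ Term (act a) := by rintro ⟨⟩

@[simp] theorem term_star {p : ACPExpr Act} : Term (star p) := .star

@[simp] theorem term_seq {p q : ACPExpr Act} : Term (seq p q) ↔ Term p ∧ Term q :=
  ⟨by rintro ⟨⟩; constructor <;> assumption, fun h => .seq h.1 h.2⟩

@[simp] theorem term_par {p q : ACPExpr Act} : Term (par p q) ↔ Term p ∧ Term q :=
  ⟨by rintro ⟨⟩; constructor <;> assumption, fun h => .par h.1 h.2⟩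

@[simp] theorem step_dl {l : Act} {r} : ¬ Step γ dl l r := by rintro ⟨⟩

@[simp] theorem step_emp {l : Act} {r} : ¬ Step γ emp l r := by rintro ⟨⟩

@[simp] theorem step_act {a l : Act} {r} : Step γ (act a) l r ↔ l = a ∧ r = emp :=
  ⟨by rintro ⟨⟩; simp, by rintro ⟨rfl, rfl⟩; exact .act⟩

theorem step_alt {p q r : ACPExpr Act} {l : Act} :
    Step γ (alt p q) l r ↔ Step γ p l r ∨ Step γ q l r :=
  ⟨by rintro (_ | h | h) <;> simp [h], by rintro (h | h); exacts [.alt_left h, .alt_right h]⟩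

theorem step_seq {p q r : ACPExpr Act} {l : Act} :
    Step γ (seq p q) l r ↔ (∃ p', Step γ p l p' ∧ r = seq p' q) ∨ (Term p ∧ Step γ q l r) := by
  constructor
  · intro h
    cases h with
    | seq_left h => exact .inl ⟨_, h, rfl⟩
    | seq_right h h' => exact .inr ⟨h, h'⟩
  · rintro (⟨p', h, rfl⟩ | ⟨h, h'⟩)
    exacts [.seq_left h, .seq_right h h']

theorem step_star {p r : ACPExpr Act} {l : Act} :
    Step γ (star p) l r ↔ ∃ p', Step γ p l p' ∧ r = seq p' (star p) := by
  constructor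
  · intro h
    cases h with
    | star h => exact ⟨_, h, rfl⟩
  · rintro ⟨p', h, rfl⟩
    exact .star h

theorem step_par {p q r : ACPExpr Act} {l : Act} :
    Step γ (par p q) l r ↔ (∃ p', Step γ p l p' ∧ r = par p' q) ∨
      (∃ q', Step γ q l q' ∧ r = par p q') ∨
      ∃ m n p' q', Step γ p m p' ∧ Step γ q n q' ∧ γ.toFun m n = some l ∧ r = par p' q' := by
  constructor
  · intro h
    cases h with
    | par_left h => exact .inl ⟨_, h, rfl⟩
    | par_right h => exact .inr (.inl ⟨_, h, rfl⟩)
    | par_comm h h' e => exact .inr (.inr ⟨_, _, _, _, h, h', e, rfl⟩)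
  · rintro (⟨p', h, rfl⟩ | ⟨p', h, rfl⟩ | ⟨m, n, p', q', h, h', e, rfl⟩)
    exacts [.par_left h, .par_right h, .par_comm h h' e]

theorem EncapFree.step {p q : ACPExpr Act} {l : Act} (h : Step γ p l q) (hp : p.EncapFree) :
    q.EncapFree := by
  induction h with
  | act => trivial
  | alt_left _ ih => exact ih hp.1
  | alt_right _ ih => exact ih hp.2
  | seq_left _ ih => exact ⟨ih hp.1, hp.2⟩
  | seq_right _ _ ih => exact ih hp.2
  | star _ ih => exact ⟨ih hp, hp⟩
  | par_left _ ih => exact ⟨ih hp.1, hp.2⟩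
  | par_right _ ih => exact ⟨hp.1, ih hp.2⟩
  | par_comm _ _ _ ih ih' => exact ⟨ih hp.1, ih' hp.2⟩
  | encap => exact hp.elim

/-- A transition with some label, when no two actions communicate. -/
def PStep (p q : ACPExpr Act) : Prop := ∃ l, Step (CommFun.empty Act) p l q

scoped infix:50 " ⟶ₚ " => PStep

@[simp] theorem pstep_dl {r : ACPExpr Act} : ¬ dl ⟶ₚ r := by simp [PStep]

@[simp] theorem pstep_emp {r : ACPExpr Act} : ¬ emp ⟶ₚ r := by simp [PStep]

@[simp] theorem pstep_act {a : Act} {r} : act a ⟶ₚ r ↔ r = emp := by simp [PStep]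

theorem pstep_alt {p q r : ACPExpr Act} : alt p q ⟶ₚ r ↔ p ⟶ₚ r ∨ q ⟶ₚ r := by
  simp [PStep, step_alt, exists_or]

theorem pstep_seq {p q r : ACPExpr Act} :
    seq p q ⟶ₚ r ↔ (∃ p', p ⟶ₚ p' ∧ r = seq p' q) ∨ (Term p ∧ q ⟶ₚ r) := by
  constructor
  · rintro ⟨l, h⟩
    rcases step_seq.1 h with ⟨p', h', rfl⟩ | ⟨hp, h'⟩
    exacts [.inl ⟨p', ⟨l, h'⟩, rfl⟩, .inr ⟨hp, l, h'⟩]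
  · rintro (⟨p', ⟨l, h⟩, rfl⟩ | ⟨hp, l, h⟩)
    exacts [⟨l, .seq_left h⟩, ⟨l, .seq_right hp h⟩]

theorem pstep_star {p r : ACPExpr Act} : star p ⟶ₚ r ↔ ∃ p', p ⟶ₚ p' ∧ r = seq p' (star p) := by
  constructor
  · rintro ⟨l, h⟩
    obtain ⟨p', h', rfl⟩ := step_star.1 h
    exact ⟨p', ⟨l, h'⟩, rfl⟩
  · rintro ⟨p', ⟨l, h⟩, rfl⟩
    exact ⟨l, .star h⟩

theorem pstep_par {p q r : ACPExpr Act} :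
    par p q ⟶ₚ r ↔ (∃ p', p ⟶ₚ p' ∧ r = par p' q) ∨ (∃ q', q ⟶ₚ q' ∧ r = par p q') := by
  constructor
  · rintro ⟨l, h⟩
    rcases step_par.1 h with ⟨p', h', rfl⟩ | ⟨q', h', rfl⟩ | ⟨_, _, _, _, _, _, ⟨⟩, _⟩
    exacts [.inl ⟨p', ⟨l, h'⟩, rfl⟩, .inr ⟨q', ⟨l, h'⟩, rfl⟩]
  · rintro (⟨p', ⟨l, h⟩, rfl⟩ | ⟨q', ⟨l, h⟩, rfl⟩)
    exacts [⟨l, .par_left h⟩, ⟨l, .par_right h⟩]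

theorem PStep.seq_left {p q p' : ACPExpr Act} (h : p ⟶ₚ p') : seq p q ⟶ₚ seq p' q :=
  pstep_seq.2 (.inl ⟨p', h, rfl⟩)

theorem PStep.seq_right {p q q' : ACPExpr Act} (hp : Term p) (h : q ⟶ₚ q') : seq p q ⟶ₚ q' :=
  pstep_seq.2 (.inr ⟨hp, h⟩)

theorem PStep.par_left {p q p' : ACPExpr Act} (h : p ⟶ₚ p') : par p q ⟶ₚ par p' q :=
  pstep_par.2 (.inl ⟨p', h, rfl⟩)

theorem PStep.par_right {p q q' : ACPExpr Act} (h : q ⟶ₚ q') : par p q ⟶ₚ par p q' :=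
  pstep_par.2 (.inr ⟨q', h, rfl⟩)

/-! ### Reachable expressions -/

/-- Reachability when no two actions communicate. -/
def Reach : ACPExpr Act → ACPExpr Act → Prop := Relation.ReflTransGen PStep

theorem Reach.refl (p : ACPExpr Act) : Reach p p := Relation.ReflTransGen.refl

theorem Reach.tail {p q r : ACPExpr Act} (h : Reach p q) (h' : q ⟶ₚ r) : Reach p r :=
  Relation.ReflTransGen.tail h h'

theorem Reach.of_step {p q r : ACPExpr Act} (h' : p ⟶ₚ q) (h : Reach q r) : Reach p r :=
  Relation.ReflTransGen.head h' h

theorem reach_alt {p q r : ACPExpr Act} (h : Reach (alt p q) r) :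
    r = alt p q ∨ Reach p r ∨ Reach q r := by
  rcases Relation.ReflTransGen.cases_head h with rfl | ⟨s, hs, h⟩
  · exact .inl rfl
  · rcases pstep_alt.1 hs with hs | hs
    exacts [.inr (.inl (.of_step hs h)), .inr (.inr (.of_step hs h))]

theorem reach_seq {p q r : ACPExpr Act} (h : Reach (seq p q) r) :
    (∃ p', Reach p p' ∧ r = seq p' q) ∨ Reach q r := by
  induction h with
  | refl => exact .inl ⟨p, .refl p, rfl⟩
  | tail _ hs ih =>
    rcases ih with ⟨p', hp, rfl⟩ | ih
    · rcases pstep_seq.1 hs with ⟨p'', h, rfl⟩ | ⟨_, h⟩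
      exacts [.inl ⟨p'', hp.tail h, rfl⟩, .inr (.of_step h (.refl _))]
    · exact .inr (ih.tail hs)

theorem reach_star {p r : ACPExpr Act} (h : Reach (star p) r) :
    r = star p ∨ ∃ p', Reach p p' ∧ r = seq p' (star p) := by
  induction h with
  | refl => exact .inl rfl
  | tail _ hs ih =>
    rcases ih with rfl | ⟨p', hp, rfl⟩
    · obtain ⟨p', h, rfl⟩ := pstep_star.1 hs
      exact .inr ⟨p', .of_step h (.refl _), rfl⟩
    · rcases pstep_seq.1 hs with ⟨p'', h, rfl⟩ | ⟨_, h⟩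
      · exact .inr ⟨p'', hp.tail h, rfl⟩
      · obtain ⟨p', h', rfl⟩ := pstep_star.1 h
        exact .inr ⟨p', .of_step h' (.refl _), rfl⟩

theorem reach_par {p q r : ACPExpr Act} (h : Reach (par p q) r) :
    ∃ p' q', Reach p p' ∧ Reach q q' ∧ r = par p' q' := by
  induction h with
  | refl => exact ⟨p, q, .refl p, .refl q, rfl⟩
  | tail _ hs ih =>
    obtain ⟨p', q', hp, hq, rfl⟩ := ih
    rcases pstep_par.1 hs with ⟨p'', h, rfl⟩ | ⟨q'', h, rfl⟩
    exacts [⟨p'', q', hp.tail h, hq, rfl⟩, ⟨p', q'', hp, hq.tail h, rfl⟩]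

/-! ### Types of expressions -/

/-- The derivatives of `witnessExpr a b c d`: the loop with `c` pending (`u0`, `u1`), the loop with
`c` done (`v0`, `v1`), the loop exited with `c` pending (`w`), and everything done (`t`). -/
inductive Node : Type
  | u0 | u1 | v0 | v1 | w | t

/-- The unlabelled transitions between the derivatives that are present for every communication
function that is defined on `(b, c)`. -/
inductive Node.Must : Node → Node → Prop
  | u0_u1 : Must u0 u1
  | u0_v0 : Must u0 v0
  | u0_w : Must u0 w
  | u1_u0 : Must u1 u0
  | u1_v0 : Must u1 v0
  | u1_v1 : Must u1 v1
  | v0_v1 : Must v0 v1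
  | v0_t : Must v0 t
  | v1_v0 : Must v1 v0
  | w_t : Must w t

/-- The unlabelled transitions that are possible for some communication function: the additional
ones are communications of `c` with `a` and with `d`. -/
inductive Node.May : Node → Node → Prop
  | must {i j} : Must i j → May i j
  | u0_v1 : May u0 v1
  | u0_t : May u0 t

open Node

/-- `M` relates nodes to expressions as an unlabelled bisimulation would, except that nodes need not
have the transitions in `Node.May` that are not in `Node.Must`. -/
structure IsTyping (M : Node → ACPExpr Act → Prop) : Prop where
  forth : ∀ {i j p}, M i p → Must i j → ∃ p', p ⟶ₚ p' ∧ M j p'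
  back : ∀ {i p p'}, M i p → p ⟶ₚ p' → ∃ j, May i j ∧ M j p'
  term : ∀ {i p}, M i p → (Term p ↔ i = t)

/-- The expression `p` has type `i`: the largest relation that `IsTyping` allows. -/
def Typ (i : Node) (p : ACPExpr Act) : Prop := ∃ M, IsTyping M ∧ M i p

theorem isTyping_typ : IsTyping (Typ (Act := Act)) where
  forth := by
    rintro i j p ⟨M, hM, h⟩ hij
    obtain ⟨p', hp, h⟩ := hM.forth h hij
    exact ⟨p', hp, M, hM, h⟩
  back := by
    rintro i p p' ⟨M, hM, h⟩ hp
    obtain ⟨j, hij, h⟩ := hM.back h hp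
    exact ⟨j, hij, M, hM, h⟩
  term := by
    rintro i p ⟨M, hM, h⟩
    exact hM.term h

variable {p q r x y z Q : ACPExpr Act} {i j : Node}

theorem Typ.forth (h : Typ i p) (hij : Must i j) : ∃ p', p ⟶ₚ p' ∧ Typ j p' :=
  isTyping_typ.forth h hij

theorem Typ.back (h : Typ i p) (hp : p ⟶ₚ q) : ∃ j, May i j ∧ Typ j q := isTyping_typ.back h hp

theorem Typ.term (h : Typ i p) : Term p ↔ i = t := isTyping_typ.term h

/-- Only `w` has all its transitions to terminating states, only `u0` has one to `w`, only `u1` has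
one to `u0`, and `v0`, unlike `v1`, has one to `t`. -/
theorem Typ.unique (hi : Typ i p) (hj : Typ j p) : i = j := by
  have ht : ∀ {i p}, Typ (Act := Act) t p → Typ i p → i = t := fun h h' => h'.term.1 (h.term.2 rfl)
  have hw : ∀ {i p}, Typ (Act := Act) w p → Typ i p → i = w := by
    intro i p h h'
    have key : ∀ {j}, Must i j → j = t := by
      intro j hij
      obtain ⟨p', hp, h1⟩ := h'.forth hij
      obtain ⟨k, hk, h2⟩ := h.back hp
      obtain ⟨⟨⟩⟩ := hk
      exact ht h2 h1
    cases i with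
    | u0 => cases key .u0_u1
    | u1 => cases key .u1_u0
    | v0 => cases key .v0_v1
    | v1 => cases key .v1_v0
    | w => rfl
    | t => cases ht h' h
  have hu0 : ∀ {i p}, Typ (Act := Act) u0 p → Typ i p → i = u0 := by
    intro i p h h'
    obtain ⟨p', hp, h1⟩ := h.forth .u0_w
    obtain ⟨k, hk, h2⟩ := h'.back hp
    cases hw h1 h2
    obtain ⟨⟨⟩⟩ := hk
    rfl
  have hu1 : ∀ {i p}, Typ (Act := Act) u1 p → Typ i p → i = u1 := by
    intro i p h h'
    obtain ⟨p', hp, h1⟩ := h.forth .u1_u0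
    obtain ⟨k, hk, h2⟩ := h'.back hp
    cases hu0 h1 h2
    obtain ⟨⟨⟩⟩ := hk
    rfl
  have hv : ∀ {p}, Typ (Act := Act) v0 p → Typ v1 p → False := by
    intro p h h'
    obtain ⟨p', hp, h1⟩ := h.forth .v0_t
    obtain ⟨k, hk, h2⟩ := h'.back hp
    cases ht h1 h2
    obtain ⟨⟨⟩⟩ := hk
  cases i with
  | u0 => exact (hu0 hi hj).symm
  | u1 => exact (hu1 hi hj).symm
  | w => exact (hw hi hj).symm
  | t => exact (ht hi hj).symm
  | v0 =>
    cases j with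
    | v0 => rfl
    | v1 => exact (hv hi hj).elim
    | u0 => exact hu0 hj hi
    | u1 => exact hu1 hj hi
    | w => exact hw hj hi
    | t => exact ht hj hi
  | v1 =>
    cases j with
    | v1 => rfl
    | v0 => exact (hv hj hi).elim
    | u0 => exact hu0 hj hi
    | u1 => exact hu1 hj hi
    | w => exact hw hj hi
    | t => exact ht hj hi

theorem Typ.may (hi : Typ i p) (hp : p ⟶ₚ q) (hj : Typ j q) : May i j := by
  obtain ⟨k, hk, h⟩ := hi.back hp
  rwa [hj.unique h]

theorem Typ.not_pstep (h : Typ t p) : ¬ p ⟶ₚ q := by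
  intro hp
  obtain ⟨_, ⟨⟨⟩⟩, _⟩ := h.back hp

/-- Types are invariant under unlabelled bisimilarity. -/
theorem Typ.of_bisim (S : ACPExpr Act → ACPExpr Act → Prop)
    (forth : ∀ p q, S p q → ∀ p', p ⟶ₚ p' → ∃ q', q ⟶ₚ q' ∧ S p' q')
    (back : ∀ p q, S p q → ∀ q', q ⟶ₚ q' → ∃ p', p ⟶ₚ p' ∧ S p' q')
    (term : ∀ p q, S p q → (Term p ↔ Term q)) (h : Typ i p) (hS : S p q) : Typ i q := by
  refine ⟨fun i q => ∃ p, Typ i p ∧ S p q, ⟨?_, ?_, ?_⟩, p, h, hS⟩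
  · rintro i j q ⟨p, h, hS⟩ hij
    obtain ⟨p', hp, h'⟩ := h.forth hij
    obtain ⟨q', hq, hS'⟩ := forth p q hS p' hp
    exact ⟨q', hq, p', h', hS'⟩
  · rintro i q q' ⟨p, h, hS⟩ hq
    obtain ⟨p', hp, hS'⟩ := back p q hS q' hq
    obtain ⟨j, hij, h'⟩ := h.back hp
    exact ⟨j, hij, p', h', hS'⟩
  · rintro i q ⟨p, h, hS⟩
    rw [← term p q hS, h.term]

theorem Typ.assoc (h : Typ i (seq (seq x y) z)) : Typ i (seq x (seq y z)) := by
  refine h.of_bisim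
    (fun p q => p = q ∨ ∃ x, p = seq (seq x y) z ∧ q = seq x (seq y z)) ?_ ?_ ?_ (.inr ⟨x, rfl, rfl⟩)
  · rintro _ _ (rfl | ⟨x, rfl, rfl⟩) p' hp
    · exact ⟨p', hp, .inl rfl⟩
    · rcases pstep_seq.1 hp with ⟨r, hr, rfl⟩ | ⟨ht, hz⟩
      · rcases pstep_seq.1 hr with ⟨x', hx, rfl⟩ | ⟨ht, hy⟩
        exacts [⟨_, hx.seq_left, .inr ⟨x', rfl, rfl⟩⟩, ⟨_, .seq_right ht hy.seq_left, .inl rfl⟩]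
      · exact ⟨_, .seq_right (term_seq.1 ht).1 (.seq_right (term_seq.1 ht).2 hz), .inl rfl⟩
  · rintro _ _ (rfl | ⟨x, rfl, rfl⟩) p' hp
    · exact ⟨p', hp, .inl rfl⟩
    · rcases pstep_seq.1 hp with ⟨x', hx, rfl⟩ | ⟨ht, hr⟩
      · exact ⟨_, hx.seq_left.seq_left, .inr ⟨x', rfl, rfl⟩⟩
      · rcases pstep_seq.1 hr with ⟨y', hy, rfl⟩ | ⟨ht', hz⟩
        exacts [⟨_, (PStep.seq_right ht hy).seq_left, .inl rfl⟩,
          ⟨_, .seq_right (term_seq.2 ⟨ht, ht'⟩) hz, .inl rfl⟩]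
  · rintro _ _ (rfl | ⟨x, rfl, rfl⟩)
    · rfl
    · simp [and_assoc]

theorem Typ.seq_emp (h : Typ i p) : Typ i (seq p emp) := by
  refine h.of_bisim (fun p q => q = seq p emp) ?_ ?_ ?_ rfl
  · rintro p _ rfl p' hp
    exact ⟨_, hp.seq_left, rfl⟩
  · rintro p _ rfl p' hp
    simpa [pstep_seq] using hp
  · rintro p _ rfl
    simp

theorem Typ.par_comm (h : Typ i (seq (par x y) Q)) : Typ i (seq (par y x) Q) := by
  have forth : ∀ {x y p' : ACPExpr Act}, seq (par x y) Q ⟶ₚ p' → ∃ q', seq (par y x) Q ⟶ₚ q' ∧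
      (p' = q' ∨ ∃ x y, p' = seq (par x y) Q ∧ q' = seq (par y x) Q) := by
    intro x y p' hp
    rcases pstep_seq.1 hp with ⟨r, hr, rfl⟩ | ⟨ht, hq⟩
    · rcases pstep_par.1 hr with ⟨x', hx, rfl⟩ | ⟨y', hy, rfl⟩
      exacts [⟨_, hx.par_right.seq_left, .inr ⟨_, _, rfl, rfl⟩⟩,
        ⟨_, hy.par_left.seq_left, .inr ⟨_, _, rfl, rfl⟩⟩]
    · exact ⟨_, .seq_right (term_par.2 (term_par.1 ht).symm) hq, .inl rfl⟩
  refine h.of_bisim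
    (fun p q => p = q ∨ ∃ x y, p = seq (par x y) Q ∧ q = seq (par y x) Q) ?_ ?_ ?_
    (.inr ⟨x, y, rfl, rfl⟩)
  · rintro _ _ (rfl | ⟨x, y, rfl, rfl⟩) p' hp
    exacts [⟨p', hp, .inl rfl⟩, forth hp]
  · rintro _ _ (rfl | ⟨x, y, rfl, rfl⟩) p' hp
    · exact ⟨p', hp, .inl rfl⟩
    · obtain ⟨q', hq, rfl | ⟨x, y, rfl, rfl⟩⟩ := forth hp
      exacts [⟨_, hq, .inl rfl⟩, ⟨_, hq, .inr ⟨_, _, rfl, rfl⟩⟩]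
  · rintro _ _ (rfl | ⟨x, y, rfl, rfl⟩)
    · rfl
    · simp [and_comm]

/-- The expression terminates and has no transitions, so it is bisimilar to `1`. -/
def Inert (p : ACPExpr Act) : Prop := Term p ∧ ∀ q, ¬ p ⟶ₚ q

theorem Typ.drop_inert (h : Typ i (seq (par x y) Q)) (hy : Inert y) : Typ i (seq x Q) := by
  refine h.of_bisim
    (fun p q => p = q ∨ ∃ x, p = seq (par x y) Q ∧ q = seq x Q) ?_ ?_ ?_ (.inr ⟨x, rfl, rfl⟩)
  · rintro _ _ (rfl | ⟨x, rfl, rfl⟩) p' hp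
    · exact ⟨p', hp, .inl rfl⟩
    · rcases pstep_seq.1 hp with ⟨r, hr, rfl⟩ | ⟨ht, hq⟩
      · rcases pstep_par.1 hr with ⟨x', hx, rfl⟩ | ⟨y', hy', rfl⟩
        exacts [⟨_, hx.seq_left, .inr ⟨x', rfl, rfl⟩⟩, (hy.2 _ hy').elim]
      · exact ⟨_, .seq_right (term_par.1 ht).1 hq, .inl rfl⟩
  · rintro _ _ (rfl | ⟨x, rfl, rfl⟩) p' hp
    · exact ⟨p', hp, .inl rfl⟩
    · rcases pstep_seq.1 hp with ⟨x', hx, rfl⟩ | ⟨ht, hq⟩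
      exacts [⟨_, hx.par_left.seq_left, .inr ⟨x', rfl, rfl⟩⟩,
        ⟨_, .seq_right (term_par.2 ⟨ht, hy.1⟩) hq, .inl rfl⟩]
  · rintro _ _ (rfl | ⟨x, rfl, rfl⟩)
    · rfl
    · simp [hy.1]

/-! ### Types of sequential compositions -/

theorem Typ.forth_seq (h : Typ i (seq p Q)) (hij : Must i j) :
    (∃ p', p ⟶ₚ p' ∧ Typ j (seq p' Q)) ∨ (Term p ∧ ∃ Q', Q ⟶ₚ Q' ∧ Typ j Q') := by
  obtain ⟨r, hr, h'⟩ := h.forth hij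
  rcases pstep_seq.1 hr with ⟨p', hp, rfl⟩ | ⟨ht, hq⟩
  exacts [.inl ⟨p', hp, h'⟩, .inr ⟨ht, r, hq, h'⟩]

/-- If `Q` has a transition to a type that only `u0` and `u1` can reach in one step, then `p·Q` can
only have type `u0` or `u1`: from each of the other types, a terminating state is reached without
returning to `u0` or `u1`, but on the way `p` would have to terminate and `Q` would offer its
transition. -/
theorem u_of_typ_seq (hQ : Q ⟶ₚ r) (hr : Typ j r) (hj : j = u0 ∨ j = u1 ∨ j = w)
    (h : Typ i (seq p Q)) : i = u0 ∨ i = u1 := by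
  have key : ∀ {i p}, Typ i (seq p Q) → Term p → i = u0 ∨ i = u1 := by
    intro i p h hp
    have := h.may (.seq_right hp hQ) hr
    rcases hj with rfl | rfl | rfl <;> obtain ⟨⟨⟩⟩ := this <;> simp
  have hnt : ∀ {p}, ¬ Typ t (seq p Q) := fun h => by
    simpa using key h (term_seq.1 (h.term.2 rfl)).1
  have hnv0 : ∀ {p}, ¬ Typ v0 (seq p Q) := fun h => by
    rcases h.forth_seq .v0_t with ⟨p', _, h'⟩ | ⟨hp, _⟩
    exacts [hnt h', by simpa using key h hp]
  cases i with
  | u0 => simp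
  | u1 => simp
  | v0 => exact (hnv0 h).elim
  | v1 =>
    rcases h.forth_seq .v1_v0 with ⟨p', _, h'⟩ | ⟨hp, _⟩
    exacts [(hnv0 h').elim, by simpa using key h hp]
  | w =>
    rcases h.forth_seq .w_t with ⟨p', _, h'⟩ | ⟨hp, _⟩
    exacts [(hnt h').elim, by simpa using key h hp]
  | t => exact (hnt h).elim

/-- If `Q` can exit to `w`, then `p·Q` cannot be of type `u1`: the transition `u1 → v0` would be
made by `Q`, and `u1` would have a transition to `w` as well. -/
theorem not_typ_u1_of_w (hQ : Q ⟶ₚ r) (hr : Typ w r) : ¬ Typ u1 (seq p Q) := by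
  intro h
  rcases h.forth_seq .u1_v0 with ⟨p', _, h'⟩ | ⟨hp, _⟩
  · simpa using u_of_typ_seq hQ hr (by simp) h'
  · obtain ⟨⟨⟩⟩ := h.may (.seq_right hp hQ) hr

/-- The expression has type `u0` or `u1`. -/
def TypU (p : ACPExpr Act) : Prop := Typ u0 p ∨ Typ u1 p

theorem TypU.forth (h : TypU p) : ∃ p', p ⟶ₚ p' ∧ TypU p' := by
  rcases h with h | h
  · obtain ⟨p', hp, h'⟩ := h.forth .u0_u1
    exact ⟨p', hp, .inr h'⟩
  · obtain ⟨p', hp, h'⟩ := h.forth .u1_u0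
    exact ⟨p', hp, .inl h'⟩

/-- `Q` has a transition into the loop `u0`, `u1`. -/
def EntersU (Q : ACPExpr Act) : Prop := ∃ Q', Q ⟶ₚ Q' ∧ TypU Q'

theorem TypU.forth_seq (h : TypU (seq p Q)) :
    (∃ p', p ⟶ₚ p' ∧ TypU (seq p' Q)) ∨ EntersU Q := by
  obtain ⟨r, hr, h⟩ := h.forth
  rcases pstep_seq.1 hr with ⟨p', hp, rfl⟩ | ⟨_, hq⟩
  exacts [.inl ⟨p', hp, h⟩, .inr ⟨r, hq, h⟩]

/-- `p` cannot stay in the loop `u0`, `u1` all by itself. -/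
def Unloopable (p : ACPExpr Act) : Prop := ∀ Q, TypU (seq p Q) → EntersU Q

/-! ### Iterations -/

/-- The loop cannot run through an iteration `x*` only: if `x*·Q` has a transition into the loop,
then so has `Q`. -/
theorem entersU_of_entersU_star (h : TypU (seq p (seq (star x) Q)))
    (hs : EntersU (seq (star x) Q)) : EntersU Q := by
  by_contra hQ
  obtain ⟨W', hW, hU⟩ := hs
  have hu : ∀ {i p}, Typ i (seq p (seq (star x) Q)) → i = u0 ∨ i = u1 := by
    intro i p h
    rcases hU with hU | hU <;> exact u_of_typ_seq hW hU (by simp) h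
  -- Steps into the loop, as well as steps made by `x`, lead to expressions `p·(x*·Q)` again.
  have star_step : ∀ {r i}, seq (star x) Q ⟶ₚ r → Typ i r →
      (∃ p, Typ i (seq p (seq (star x) Q))) ∨ Q ⟶ₚ r := by
    intro r i hr h
    rcases pstep_seq.1 hr with ⟨y, hy, rfl⟩ | ⟨_, hr⟩
    · obtain ⟨p, _, rfl⟩ := pstep_star.1 hy
      exact .inl ⟨p, h.assoc⟩
    · exact .inr hr
  have hu0 : ∃ p, Typ u0 (seq p (seq (star x) Q)) := by
    rcases h with h | h
    · exact ⟨p, h⟩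
    · rcases h.forth_seq .u1_u0 with ⟨p', _, h'⟩ | ⟨_, r, hr, h'⟩
      · exact ⟨p', h'⟩
      · exact (star_step hr h').resolve_right fun hr => hQ ⟨r, hr, .inl h'⟩
  obtain ⟨p₀, h0⟩ := hu0
  have hu1 : ∃ p, Typ u1 (seq p (seq (star x) Q)) := by
    rcases h0.forth_seq .u0_u1 with ⟨p', _, h'⟩ | ⟨_, r, hr, h'⟩
    · exact ⟨p', h'⟩
    · exact (star_step hr h').resolve_right fun hr => hQ ⟨r, hr, .inr h'⟩
  obtain ⟨p₁, h1⟩ := hu1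
  rcases h0.forth_seq .u0_w with ⟨p', _, h'⟩ | ⟨_, r, hr, h'⟩
  · simpa using hu h'
  · exact not_typ_u1_of_w hr h' h1

/-! ### Parallel compositions -/

theorem Typ.inert_of_seq (h : Typ t (seq p Q)) : Inert p ∧ Inert Q := by
  have ht := term_seq.1 (h.term.2 rfl)
  exact ⟨⟨ht.1, fun q hq => h.not_pstep hq.seq_left⟩, ht.2,
    fun q hq => h.not_pstep (.seq_right ht.1 hq)⟩

theorem Inert.of_par (h : Inert (par x y)) : Inert x ∧ Inert y := by
  have ht := term_par.1 h.1
  exact ⟨⟨ht.1, fun q hq => h.2 _ hq.par_left⟩, ht.2,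
    fun q hq => h.2 _ hq.par_right⟩

theorem Typ.forth_par (h : Typ i (seq (par x y) Q)) (hij : Must i j) :
    (∃ x', x ⟶ₚ x' ∧ Typ j (seq (par x' y) Q)) ∨ (∃ y', y ⟶ₚ y' ∧ Typ j (seq (par x y') Q)) ∨
      (Term x ∧ Term y ∧ ∃ Q', Q ⟶ₚ Q' ∧ Typ j Q') := by
  rcases h.forth_seq hij with ⟨p', hp, h'⟩ | ⟨ht, hQ⟩
  · rcases pstep_par.1 hp with ⟨x', hx, rfl⟩ | ⟨y', hy, rfl⟩
    exacts [.inl ⟨x', hx, h'⟩, .inr (.inl ⟨y', hy, h'⟩)]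
  · exact .inr (.inr ⟨(term_par.1 ht).1, (term_par.1 ht).2, hQ⟩)

theorem Typ.back_par_left (h : Typ i (seq (par x y) Q)) (hx : x ⟶ₚ z) :
    ∃ j, May i j ∧ Typ j (seq (par z y) Q) :=
  h.back hx.par_left.seq_left

theorem Typ.back_par_right (h : Typ i (seq (par x y) Q)) (hy : y ⟶ₚ z) :
    ∃ j, May i j ∧ Typ j (seq (par x z) Q) :=
  h.back hy.par_right.seq_left

/-- If a single step is left in `y`, then `x ∥ y` cannot make both of the transitions `u1 → v0` and
`u1 → v1`: the step of `y` can only be one of them, and the types `v0` and `v1` do not allow that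
it is still pending. -/
theorem not_typ_u1_par (hQ : Inert Q) (hy : ¬ Term y)
    (hin : ∀ z, y ⟶ₚ z → Inert z) : ¬ Typ u1 (seq (par x y) Q) := by
  intro h
  have hv0 : ∀ {x}, ¬ Typ v0 (seq (par x y) Q) := by
    intro x h
    rcases h.forth_par .v0_t with ⟨x', _, h'⟩ | ⟨y', hy', h'⟩ | ⟨_, ht, _⟩
    · exact hy h'.inert_of_seq.1.of_par.2.1
    · have hx := h'.inert_of_seq.1.of_par.1
      rcases h.forth_par .v0_v1 with ⟨x', hx', _⟩ | ⟨y'', hy'', h''⟩ | ⟨_, ht, _⟩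
      · exact hx.2 _ hx'
      · rcases h''.forth_par .v1_v0 with ⟨_, hs, _⟩ | ⟨_, hs, _⟩ | ⟨_, _, _, hs, _⟩
        exacts [hx.2 _ hs, (hin _ hy'').2 _ hs, hQ.2 _ hs]
      · exact hy ht
    · exact hy ht
  rcases h.forth_par .u1_v0 with ⟨x', _, h'⟩ | ⟨y', hy', h0⟩ | ⟨_, ht, _⟩
  · exact hv0 h'
  · rcases h.forth_par .u1_v1 with ⟨x', _, h1⟩ | ⟨y'', hy'', h1⟩ | ⟨_, ht, _⟩
    · obtain ⟨j, hj, h2⟩ := h1.back_par_right hy'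
      obtain ⟨⟨⟩⟩ := hj
      -- As `y'` is inert, `x'` can make the exit `v0 → t`; but `x' ∥ y` has type `v1`, so making it
      -- before the step of `y` would lead to type `v0`.
      rcases h2.forth_par .v0_t with ⟨s, hs, _⟩ | ⟨_, hs, _⟩ | ⟨_, _, _, hs, _⟩
      · obtain ⟨k, hk, h3⟩ := h1.back_par_left hs
        obtain ⟨⟨⟩⟩ := hk
        exact hv0 h3
      · exact (hin _ hy').2 _ hs
      · exact hQ.2 _ hs
    · cases (h0.drop_inert (hin _ hy')).unique (h1.drop_inert (hin _ hy''))
    · exact hy ht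
  · exact hy ht

/-- If the left component makes the exit `u0 → w`, then the right one either is inert up to one last
step, the pending `c`, or can be dropped. -/
theorem entersU_of_typ_w_left (hx : Unloopable x) (h : Typ u0 (seq (par x y) Q))
    (hw : Typ w (seq (par z y) Q)) : EntersU Q := by
  have peel : ∀ {y'}, Inert y' → TypU (seq (par x y') Q) → EntersU Q := fun hi hU =>
    hx Q (hU.imp (·.drop_inert hi) (·.drop_inert hi))
  rcases hw.forth_par .w_t with ⟨x', _, h'⟩ | ⟨y', hy', h'⟩ | ⟨_, hty, Q', hQ', _⟩
  · exact peel h'.inert_of_seq.1.of_par.2 (.inl h)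
  · have hi := h'.inert_of_seq
    have hin : ∀ v, y ⟶ₚ v → Inert v := by
      intro v hv
      obtain ⟨j, hj, h2⟩ := hw.back_par_right hv
      obtain ⟨⟨⟩⟩ := hj
      exact h2.inert_of_seq.1.of_par.2
    have hnt : ¬ Term y := fun ht => by
      simpa using hw.term.1 (term_seq.2 ⟨term_par.2 ⟨hi.1.of_par.1.1, ht⟩, hi.2.1⟩)
    rcases h.forth_par .u0_u1 with ⟨x₁, _, h1⟩ | ⟨v, hv, h1⟩ | ⟨_, ht, _⟩
    · exact (not_typ_u1_par hi.2 hnt hin h1).elim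
    · exact peel (hin v hv) (.inr h1)
    · exact (hnt ht).elim
  · refine peel ⟨hty, fun v hv => ?_⟩ (.inl h)
    obtain ⟨j, hj, h2⟩ := hw.back_par_right hv
    obtain ⟨⟨⟩⟩ := hj
    exact h2.inert_of_seq.2.2 _ hQ'

theorem unloopable_par (hx : ∀ x', Reach x x' → Unloopable x')
    (hy : ∀ y', Reach y y' → Unloopable y') : Unloopable (par x y) := by
  intro Q h
  by_contra hQ
  have hu0 : ∃ x' y', Reach x x' ∧ Reach y y' ∧ Typ u0 (seq (par x' y') Q) := by
    rcases h with h | h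
    · exact ⟨x, y, .refl x, .refl y, h⟩
    · rcases h.forth_par .u1_u0 with ⟨x', hs, h'⟩ | ⟨y', hs, h'⟩ | ⟨_, _, Q', hs, h'⟩
      exacts [⟨x', y, .of_step hs (.refl _), .refl y, h'⟩,
        ⟨x, y', .refl x, .of_step hs (.refl _), h'⟩, (hQ ⟨Q', hs, .inl h'⟩).elim]
  obtain ⟨x', y', rx, ry, h0⟩ := hu0
  rcases h0.forth_par .u0_w with ⟨z, _, hw⟩ | ⟨z, _, hw⟩ | ⟨_, _, Q', hs, hw⟩
  · exact hQ (entersU_of_typ_w_left (hx _ rx) h0 hw)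
  · exact hQ (entersU_of_typ_w_left (hy _ ry) h0.par_comm hw.par_comm)
  · rcases h0.forth_seq .u0_u1 with ⟨p', _, h1⟩ | ⟨_, r, hr, h1⟩
    exacts [not_typ_u1_of_w hs hw h1, hQ ⟨r, hr, .inr h1⟩]

/-! ### Expressions without encapsulation -/

theorem unloopable_dl : Unloopable (dl : ACPExpr Act) := by
  intro Q h
  rcases h.forth_seq with ⟨_, hs, _⟩ | h
  exacts [(pstep_dl hs).elim, h]

theorem unloopable_emp : Unloopable (emp : ACPExpr Act) := by
  intro Q h
  rcases h.forth_seq with ⟨_, hs, _⟩ | h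
  exacts [(pstep_emp hs).elim, h]

theorem Unloopable.of_succ (h : ∀ q, p ⟶ₚ q → Unloopable q) : Unloopable p := by
  intro Q hU
  rcases hU.forth_seq with ⟨q, hs, hq⟩ | hU
  exacts [h q hs Q hq, hU]

/-- No expression without encapsulation can stay in the loop `u0`, `u1`; the statement about all
reachable expressions is the one that can be proved by structural induction. -/
theorem unloopable_of_reach (hp : p.EncapFree) (h : Reach p q) : Unloopable q := by
  induction p generalizing q with
  | dl =>
    rcases Relation.ReflTransGen.cases_head h with rfl | ⟨s, hs, _⟩
    exacts [unloopable_dl, (pstep_dl hs).elim]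
  | emp =>
    rcases Relation.ReflTransGen.cases_head h with rfl | ⟨s, hs, _⟩
    exacts [unloopable_emp, (pstep_emp hs).elim]
  | act a =>
    rcases Relation.ReflTransGen.cases_head h with rfl | ⟨s, hs, h⟩
    · refine .of_succ fun q hq => ?_
      rw [pstep_act.1 hq]
      exact unloopable_emp
    · rw [pstep_act] at hs
      subst hs
      rcases Relation.ReflTransGen.cases_head h with rfl | ⟨s, hs, _⟩
      exacts [unloopable_emp, (pstep_emp hs).elim]
  | seq x y ihx ihy =>
    rcases reach_seq h with ⟨x', hx, rfl⟩ | h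
    · intro Q hU
      obtain ⟨r, hr, hr'⟩ := ihx hp.1 hx (.seq y Q) (hU.imp (·.assoc) (·.assoc))
      rcases pstep_seq.1 hr with ⟨y', hy, rfl⟩ | ⟨_, hr⟩
      exacts [ihy hp.2 (.of_step hy (.refl _)) Q hr', ⟨r, hr, hr'⟩]
    · exact ihy hp.2 h
  | alt x y ihx ihy =>
    rcases reach_alt h with rfl | h | h
    · refine .of_succ fun q hq => ?_
      rcases pstep_alt.1 hq with hq | hq
      exacts [ihx hp.1 (.of_step hq (.refl _)), ihy hp.2 (.of_step hq (.refl _))]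
    exacts [ihx hp.1 h, ihy hp.2 h]
  | star x ih =>
    have key : ∀ {x'}, Reach x x' → Unloopable (.seq x' (star x)) := by
      intro x' hx Q hU
      have hU' : TypU (.seq x' (.seq (star x) Q)) := hU.imp (·.assoc) (·.assoc)
      exact entersU_of_entersU_star hU' (ih hp hx _ hU')
    rcases reach_star h with rfl | ⟨x', hx, rfl⟩
    · refine .of_succ fun q hq => ?_
      obtain ⟨x', hx, rfl⟩ := pstep_star.1 hq
      exact key (.of_step hx (.refl _))
    · exact key hx
  | par x y ihx ihy =>
    obtain ⟨x', y', hx, hy, rfl⟩ := reach_par h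
    exact unloopable_par (fun _ h => ihx hp.1 (hx.trans h)) (fun _ h => ihy hp.2 (hy.trans h))
  | encap H x _ => exact hp.elim

theorem not_typ_u0 (hp : p.EncapFree) : ¬ Typ u0 p := by
  intro h
  obtain ⟨Q, hQ, _⟩ := unloopable_of_reach hp (.refl p) emp (.inl h.seq_emp)
  exact pstep_emp hQ

/-! ### The derivatives of the witness -/

/-- The loop `1·(a·b)*·d` before an `a`. -/
def loop (a b d : Act) : ACPExpr Act := seq (seq emp (star (seq (act a) (act b)))) (act d)

/-- The loop `1·(a·b)*·d` after an `a`. -/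
def loop' (a b d : Act) : ACPExpr Act :=
  seq (seq (seq emp (act b)) (star (seq (act a) (act b)))) (act d)

/-- The derivatives of `witnessExpr a b c d`. -/
def Node.expr (a b c d : Act) : Node → ACPExpr Act
  | u0 => par (loop a b d) (act c)
  | u1 => par (loop' a b d) (act c)
  | v0 => par (loop a b d) emp
  | v1 => par (loop' a b d) emp
  | w => par emp (act c)
  | t => par emp emp

variable {a b c d e l : Act}

theorem step_loop : Step γ (loop a b d) l r ↔ (l = a ∧ r = loop' a b d) ∨ (l = d ∧ r = emp) := by
  simp only [loop, loop', step_seq, step_star, step_act, step_emp, term_emp, term_star, term_act,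
    term_seq]
  grind

theorem step_loop' : Step γ (loop' a b d) l r ↔ l = b ∧ r = loop a b d := by
  simp only [loop, loop', step_seq, step_star, step_act, step_emp, term_emp, term_star, term_act,
    term_seq]
  grind

@[simp] theorem term_loop : ¬ Term (loop a b d) := by simp [loop]

@[simp] theorem term_loop' : ¬ Term (loop' a b d) := by simp [loop']

theorem step_u0 : Step γ (u0.expr a b c d) l r ↔
    (l = a ∧ r = u1.expr a b c d) ∨ (l = d ∧ r = w.expr a b c d) ∨ (l = c ∧ r = v0.expr a b c d) ∨
    (γ.toFun a c = some l ∧ r = v1.expr a b c d) ∨ (γ.toFun d c = some l ∧ r = t.expr a b c d) := by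
  simp only [Node.expr, step_par, step_loop, step_act]
  grind

theorem step_u1 : Step γ (u1.expr a b c d) l r ↔
    (l = b ∧ r = u0.expr a b c d) ∨ (l = c ∧ r = v1.expr a b c d) ∨
    (γ.toFun b c = some l ∧ r = v0.expr a b c d) := by
  simp only [Node.expr, step_par, step_loop', step_act]
  grind

theorem step_v0 : Step γ (v0.expr a b c d) l r ↔
    (l = a ∧ r = v1.expr a b c d) ∨ (l = d ∧ r = t.expr a b c d) := by
  simp only [Node.expr, step_par, step_loop, step_emp]
  grind

theorem step_v1 : Step γ (v1.expr a b c d) l r ↔ l = b ∧ r = v0.expr a b c d := by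
  simp only [Node.expr, step_par, step_loop', step_emp]
  grind

theorem step_w : Step γ (w.expr a b c d) l r ↔ l = c ∧ r = t.expr a b c d := by
  simp only [Node.expr, step_par, step_act, step_emp]
  grind

theorem step_t : ¬ Step γ (t.expr a b c d) l r := by
  simp [Node.expr, step_par]

theorem Node.expr_injective : Function.Injective (Node.expr a b c d) := by
  intro i j h
  cases i <;> cases j <;> simp_all [Node.expr, loop, loop']

theorem Node.term_expr {i : Node} : Term (i.expr a b c d) ↔ i = t := by
  cases i <;> simp [Node.expr]

theorem Node.Must.step (h : Must i j) (hbc : γ.toFun b c = some e) :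
    ∃ l, Step γ (i.expr a b c d) l (j.expr a b c d) := by
  cases h with
  | u0_u1 => exact ⟨a, step_u0.2 (by simp)⟩
  | u0_v0 => exact ⟨c, step_u0.2 (by simp)⟩
  | u0_w => exact ⟨d, step_u0.2 (by simp)⟩
  | u1_u0 => exact ⟨b, step_u1.2 (by simp)⟩
  | u1_v0 => exact ⟨e, step_u1.2 (by simp [hbc])⟩
  | u1_v1 => exact ⟨c, step_u1.2 (by simp)⟩
  | v0_v1 => exact ⟨a, step_v0.2 (by simp)⟩
  | v0_t => exact ⟨d, step_v0.2 (by simp)⟩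
  | v1_v0 => exact ⟨b, step_v1.2 (by simp)⟩
  | w_t => exact ⟨c, step_w.2 (by simp)⟩

theorem Node.May.of_step (h : Step γ (i.expr a b c d) l r) :
    ∃ j, May i j ∧ r = j.expr a b c d := by
  cases i with
  | u0 =>
    rcases step_u0.1 h with ⟨_, h⟩ | ⟨_, h⟩ | ⟨_, h⟩ | ⟨_, h⟩ | ⟨_, h⟩
    exacts [⟨_, .must .u0_u1, h⟩, ⟨_, .must .u0_w, h⟩, ⟨_, .must .u0_v0, h⟩, ⟨_, .u0_v1, h⟩,
      ⟨_, .u0_t, h⟩]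
  | u1 =>
    rcases step_u1.1 h with ⟨_, h⟩ | ⟨_, h⟩ | ⟨_, h⟩
    exacts [⟨_, .must .u1_u0, h⟩, ⟨_, .must .u1_v1, h⟩, ⟨_, .must .u1_v0, h⟩]
  | v0 =>
    rcases step_v0.1 h with ⟨_, h⟩ | ⟨_, h⟩
    exacts [⟨_, .must .v0_v1, h⟩, ⟨_, .must .v0_t, h⟩]
  | v1 => exact ⟨_, .must .v1_v0, (step_v1.1 h).2⟩
  | w => exact ⟨_, .must .w_t, (step_w.1 h).2⟩
  | t => exact (step_t h).elim

/-- The witness is not expressible without communication. The labels are irrelevant: the actions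
may even be equal. -/
theorem not_bisimilar_witness (hbc : γ.toFun b c = some e) (q : (PA Act).State) :
    ¬ TSS.Bisimilar (ACP γ) (PA Act) (witnessExpr a b c d) q := by
  rintro ⟨R, hR, hq⟩
  refine not_typ_u0 q.2 ⟨fun i p => ∃ h : p.EncapFree, R (i.expr a b c d) ⟨p, h⟩, ⟨?_, ?_, ?_⟩,
    q.2, hq⟩
  · rintro i j p ⟨hp, h⟩ hij
    obtain ⟨l, hl⟩ := hij.step hbc
    obtain ⟨p', hs, h'⟩ := hR.forth _ _ h l _ hl
    exact ⟨p'.1, ⟨l, hs⟩, p'.2, h'⟩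
  · rintro i p p' ⟨hp, h⟩ ⟨l, hs⟩
    obtain ⟨s, hs', h'⟩ := hR.back _ _ h l ⟨p', EncapFree.step hs hp⟩ hs
    obtain ⟨j, hj, rfl⟩ := Node.May.of_step hs'
    exact ⟨j, hj, _, h'⟩
  · rintro i p ⟨hp, h⟩
    exact (hR.term _ _ h).symm.trans Node.term_expr

/-! ### The component of the witness -/

/-- The loop `u0`, `u1` of derivatives of the witness. -/
def uLoop (γ : CommFun Act) (a b c d : Act) : Set (ACP γ).State :=
  {u0.expr a b c d, u1.expr a b c d}

theorem not_u_of_reachable {s : (ACP γ).State} (hi : i ≠ u0 ∧ i ≠ u1)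
    (h : (ACP γ).Reachable (i.expr a b c d) s) :
    ∃ j, s = Node.expr a b c d j ∧ j ≠ u0 ∧ j ≠ u1 := by
  induction h with
  | refl => exact ⟨i, rfl, hi⟩
  | tail _ hs ih =>
    obtain ⟨j, rfl, hj⟩ := ih
    obtain ⟨l, hs⟩ := hs
    obtain ⟨k, hk, rfl⟩ := Node.May.of_step hs
    refine ⟨k, rfl, ?_⟩
    cases j <;> simp_all <;> obtain ⟨⟨⟩⟩ := hk <;> simp

theorem exists_node_of_reachable {s : (ACP γ).State}
    (h : (ACP γ).Reachable (i.expr a b c d) s) : ∃ j, s = Node.expr a b c d j := by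
  induction h with
  | refl => exact ⟨i, rfl⟩
  | tail _ hs ih =>
    obtain ⟨j, rfl⟩ := ih
    obtain ⟨l, hs⟩ := hs
    obtain ⟨k, _, rfl⟩ := Node.May.of_step hs
    exact ⟨k, rfl⟩

theorem reachable_u0_u1 : (ACP γ).Reachable (u0.expr a b c d) (u1.expr a b c d) :=
  .single ⟨a, step_u0.2 (by simp)⟩

theorem reachable_u1_u0 : (ACP γ).Reachable (u1.expr a b c d) (u0.expr a b c d) :=
  .single ⟨b, step_u1.2 (by simp)⟩

theorem isSCC_uLoop : (ACP γ).IsSCC (uLoop γ a b c d) := by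
  constructor
  · rintro s (rfl | rfl) s' (rfl | rfl)
    exacts [.refl, reachable_u0_u1, reachable_u1_u0, .refl]
  · intro D hD hC s hs
    have h0 := hC (Set.mem_insert _ _)
    obtain ⟨i, rfl⟩ := exists_node_of_reachable (hD _ h0 _ hs)
    by_contra hi
    obtain ⟨j, hj, hj'⟩ := not_u_of_reachable (i := i) ⟨by rintro rfl; exact hi (.inl rfl),
      by rintro rfl; exact hi (.inr rfl)⟩ (hD _ hs _ h0)
    exact hj'.1 (Node.expr_injective hj).symm

theorem expr_notMem_uLoop (hi : i ≠ u0 ∧ i ≠ u1) : i.expr a b c d ∉ uLoop γ a b c d := by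
  rintro (h | h)
  exacts [hi.1 (Node.expr_injective h), hi.2 (Node.expr_injective h)]

theorem normed_w : (ACP γ).Normed (w.expr a b c d) :=
  ⟨t.expr a b c d, .single ⟨c, step_w.2 (by simp)⟩, Node.term_expr.2 rfl⟩

theorem normed_v0 : (ACP γ).Normed (v0.expr a b c d) :=
  ⟨t.expr a b c d, .single ⟨d, step_v0.2 (by simp)⟩, Node.term_expr.2 rfl⟩

theorem not_sameSCC_t_v0 : ¬ (ACP γ).SameSCC (t.expr a b c d) (v0.expr a b c d) := by
  rintro ⟨C, hC, ht, hv⟩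
  rcases Relation.ReflTransGen.cases_head (hC.1 _ ht _ hv) with h | ⟨s, ⟨l, hs⟩, _⟩
  · cases Node.expr_injective h
  · exact step_t hs

theorem mem_normedExits_u0 :
    (d, w.expr a b c d) ∈ (ACP γ).normedExits (uLoop γ a b c d) (u0.expr a b c d) :=
  ⟨⟨step_u0.2 (by simp), expr_notMem_uLoop (i := w) (by simp)⟩,
    normed_w (a := a) (b := b) (c := c) (d := d)⟩

theorem mem_normedExits_u1 (hbc : γ.toFun b c = some e) :
    (e, v0.expr a b c d) ∈ (ACP γ).normedExits (uLoop γ a b c d) (u1.expr a b c d) :=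
  ⟨⟨step_u1.2 (by simp [hbc]), expr_notMem_uLoop (i := v0) (by simp)⟩,
    normed_v0 (a := a) (b := b) (c := c) (d := d)⟩

/-- The state `u0` cannot match the exit `e` of `u1` to `v0`, and `u1` cannot match the exit `d`
of `u0` to `w`. -/
theorem not_isMaximalAliveExit (hd : [a, b, c, d, e].Nodup) (hbc : γ.toFun b c = some e)
    (hac : γ.toFun a c ≠ some e) (s : (ACP γ).State) :
    ¬ (ACP γ).IsMaximalAliveExit (uLoop γ a b c d) s := by
  rintro ⟨⟨hs, -⟩, hmax⟩
  simp only [List.nodup_cons, List.mem_cons, List.not_mem_nil, or_false, not_or] at hd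
  rcases hs with rfl | rfl
  · obtain ⟨⟨l, r⟩, ⟨⟨hstep, -⟩, -⟩, hl, hscc⟩ := hmax _ ⟨.inr rfl, .inr ⟨_, mem_normedExits_u1 hbc⟩⟩
      _ (mem_normedExits_u1 hbc)
    obtain rfl : l = e := hl
    rcases step_u0.1 hstep with ⟨h, _⟩ | ⟨h, _⟩ | ⟨h, _⟩ | ⟨h, _⟩ | ⟨_, h⟩
    · exact hd.1.2.2.2 h.symm
    · exact hd.2.2.2.1 h.symm
    · exact hd.2.2.1.2 h.symm
    · exact hac h
    · obtain rfl : r = t.expr a b c d := h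
      exact not_sameSCC_t_v0 (c := c) hscc
  · obtain ⟨⟨l, r⟩, ⟨⟨hstep, -⟩, -⟩, hl, -⟩ := hmax _ ⟨.inl rfl, .inr ⟨_, mem_normedExits_u0⟩⟩
      _ mem_normedExits_u0
    obtain rfl : l = d := hl
    rcases step_u1.1 hstep with ⟨h, _⟩ | ⟨h, _⟩ | ⟨h, _⟩
    · exact hd.2.1.2.1 h.symm
    · exact hd.2.2.1.1 h.symm
    · rw [hbc] at h
      exact hd.2.2.2.1 (Option.some.inj h).symm

end ACPExpr

/-! ### Expressiveness -/

/-- The communication function for which `a` communicates with itself, with result `a`, and no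
other communication is defined. -/
noncomputable def CommFun.self {Act : Type u} (a : Act) : CommFun Act where
  toFun x y := open Classical in if x = a ∧ y = a then some a else none
  comm x y := by by_cases hx : x = a <;> by_cases hy : y = a <;> simp [hx, hy]
  assoc x y z := by
    by_cases hx : x = a <;> by_cases hy : y = a <;> by_cases hz : z = a <;> simp [hx, hy, hz]

theorem bisimilar_PA_ACPUnion {Act : Type u} (p : (PA Act).State) :
    TSS.Bisimilar (PA Act) (ACPUnion Act) p (CommFun.empty Act, p.1) := by
  refine ⟨fun p q => q = (CommFun.empty Act, p.1), ⟨?_, ?_, ?_⟩, rfl⟩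
  · rintro p _ rfl l p' hs
    exact ⟨(CommFun.empty Act, p'.1), ⟨rfl, hs⟩, rfl⟩
  · rintro p _ rfl l ⟨γ, q⟩ ⟨hγ, hs⟩
    obtain rfl : γ = CommFun.empty Act := hγ
    exact ⟨⟨q, ACPExpr.EncapFree.step hs p.2⟩, hs, rfl⟩
  · rintro p _ rfl
    rfl

theorem TSS.Bisimilar.of_ACPUnion {Act : Type u} {γ : CommFun Act} {q : (PA Act).State}
    {p : (ACP γ).State} (h : TSS.Bisimilar (PA Act) (ACPUnion Act) q (γ, p)) :
    TSS.Bisimilar (ACP γ) (PA Act) p q := by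
  obtain ⟨R, hR, h⟩ := h
  refine ⟨fun p q => R q (γ, p), ⟨?_, ?_, ?_⟩, h⟩
  · intro p q h l p' hs
    exact hR.back _ _ h l (γ, p') ⟨rfl, hs⟩
  · intro p q h l q' hs
    obtain ⟨⟨γ', p'⟩, ⟨hγ, hs'⟩, h'⟩ := hR.forth _ _ h l q' hs
    obtain rfl : γ' = γ := hγ
    exact ⟨p', hs', h'⟩
  · intro p q h
    exact (hR.term _ _ h).symm

open ACPExpr in
theorem mainTheorem2 {Act : Type u} [Nonempty Act] :
    TSS.LessExpressive (PA Act) (ACPUnion Act) ∧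
    ∀ (γ : CommFun Act) (a b c d e : Act), [a, b, c, d, e].Nodup →
      γ.toFun b c = some e → γ.toFun a c ≠ some e →
      (∃ C : Set (ACP γ).State,
        (ACP γ).IsSCC C ∧ ¬ (ACP γ).IsTrivial C ∧ witnessExpr a b c d ∈ C ∧
        (∃ s, (ACP γ).IsAliveExit C s) ∧
        ¬ ∃ s, (ACP γ).IsMaximalAliveExit C s) ∧
      ∀ q : (PA Act).State, ¬ TSS.Bisimilar (ACP γ) (PA Act) (witnessExpr a b c d) q := by
  refine ⟨⟨fun p => ⟨_, bisimilar_PA_ACPUnion p⟩, ?_⟩, ?_⟩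
  · obtain ⟨a⟩ := ‹Nonempty Act›
    refine ⟨(CommFun.self a, witnessExpr a a a a), fun q h => ?_⟩
    exact not_bisimilar_witness (e := a) (by simp [CommFun.self]) q h.of_ACPUnion
  · intro γ a b c d e hd hbc hac
    refine ⟨⟨uLoop γ a b c d, isSCC_uLoop, ?_, .inl rfl, ⟨_, .inl rfl, .inr ⟨_, mem_normedExits_u0⟩⟩,
      fun ⟨s, hs⟩ => not_isMaximalAliveExit hd hbc hac s hs⟩, not_bisimilar_witness hbc⟩
    rintro ⟨s, hs, -⟩
    have h0 : Node.u0.expr a b c d ∈ uLoop γ a b c d := .inl rfl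
    have h1 : Node.u1.expr a b c d ∈ uLoop γ a b c d := .inr rfl
    rw [hs] at h0 h1
    cases Node.expr_injective (h0.trans h1.symm)
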